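/- A labelled open graph is a tuple $\Gamma=(G,I,O,\lambda)$ with $G=(V,E)$ a finite simple graph, $I,O\subseteq V$, and $\lambda:V\setminus O\to\{X,Y,Z,XY,XZ,YZ\}$. Write $\overline I=V\setminus I$ and $\overline O=V\setminus O$. For $A\subseteq V$ let $\mathrm{Odd}(A)$ be the set of vertices with an odd number of neighbours in $A$, and $\mathrm{Odd}[A]=\mathrm{Odd}(A)\,\Delta\,A$, where $\Delta$ is symmetric difference. Labels $XY,XZ,YZ$ are called planar. A Pauli flow on $\Gamma$ is a pair $(c,\prec)$ of a map $c:\overline O\to\mathcal P(\overline I)$ and a strict partial order $\prec$ on $\overline O$ such that for all $u\in\overline O$ and all $v\in\overline O\setminus\{u\}$: if $v\in c(u)$ and $\lambda(v)\notin\{X,Y\}$ then $u\prec v$; if $v\in\mathrm{Odd}(c(u))$ and $\lambda(v)\notin\{Y,Z\}$ then $u\prec v$; if $\lambda(v)=Y$ and $\neg(u\prec v)$ then $v\notin\mathrm{Odd}[c(u)]$; and moreover, if $\lambda(u)=XY$ then $u\notin c(u)$ and $u\in\mathrm{Odd}(c(u))$; if $\lambda(u)=XZ$ then $u\in c(u)$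 and $u\in\mathrm{Odd}(c(u))$; if $\lambda(u)=YZ$ then $u\in c(u)$ and $u\notin\mathrm{Odd}(c(u))$; if $\lambda(u)=X$ then $u\in\mathrm{Odd}(c(u))$; if $\lambda(u)=Z$ then $u\in c(u)$; if $\lambda(u)=Y$ then $u\in\mathrm{Odd}[c(u)]$. A gflow is a Pauli flow on a labelled open graph all of whose labels are planar. A set $A\subseteq\overline I$ is focused over $S\subseteq\overline O$ if for all $w\in S$: $w\in A$ implies $\lambda(w)\in\{XY,X,Y\}$; $w\in\mathrm{Odd}(A)$ implies $\lambda(w)\in\{XZ,YZ,Y,Z\}$; and $\lambda(w)=Y$ implies $w\notin\mathrm{Odd}[A]$. A Pauli flow is focused if $c(v)$ is focused over $\overline O\setminus\{v\}$ for all $v\in\overline O$. Let $\mathcal X=\{v\in\overline O:\lambda(v)\in\{XY,X,Y\}\}$ and $\mathcal L=\{v\in V\setminus(I\cup O):\lambda(v)\in\{XY,XZ,YZ\}\}$. **Theorem.** Let $\Gamma$ be a labelled open graph with $|I|=|O|$, let $x\in\overline O\cap\overline I$ with $\lambda(x)=XY$, and let $W\subseteq V\setminus\{x\}$. Let $\Gamma'=(G',I,O,\lambda')$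 result from splitting $x$ over $W$: $G'$ has vertex set $V\cup\{x',x''\}$, with $x',x''$ two new vertices, and edge set $E\,\Delta\,\{\{x,x'\},\{x',x''\}\}\,\Delta\,\{\{y,w\}:y\in\{x,x''\},\,w\in W\}$, and $\lambda'$ extends $\lambda$ by $\lambda'(x')=\lambda'(x'')=XY$. Then any two focused Pauli flows on $\Gamma$ have the same correction function $c$, and if $\Gamma$ has a Pauli flow then there is a unique set $K\subseteq\overline I$ such that $\overline O\setminus(W\cap\mathcal X)$ is the largest set over which $K$ is focused. Moreover, $\Gamma'$ has a Pauli flow if and only if there exists a focused Pauli flow $(c,\prec)$ on $\Gamma$ such that, with $K$ this unique set, - (V1) $|W\cap K|$ is even; - (V2) with $\mathcal W_{pred}=\{w\in\overline O:|c(w)\cap W|\text{ is odd}\}$ and $\mathcal V_{succ}=\mathcal L\cap\bigl(K\cup(\mathrm{Odd}(K)\,\Delta\,W)\bigr)$, all $w\in\mathcal W_{pred}$ and $v\in\mathcal V_{succ}$ satisfy $\neg(v\prec w\vee v=w)$; - (V3) for all $u\in\overline O$, $x\prec u$ implies $u\notin\mathcal W_{pred}$, and $u\prec x$ implies $u\notin\mathcal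 V_{succ}$; - (V4) $x\in K$ if and only if $|c(x)\cap W|$ is even. If all labels of $\Gamma$ are planar, then so are all labels of $\Gamma'$, and $\Gamma'$ has a gflow if and only if the same condition holds. -/

import Mathlib

/-- The six measurement labels. -/
inductive MeasLabel : Type
  | X | Y | Z | XY | XZ | YZ

/-- A labelled open graph `(G, I, O, lam)` on the vertex set `V`; the labelling is defined exactly
on the non-output vertices. -/
structure LabelledOpenGraph (V : Type*) where
  graph : SimpleGraph V
  I : Set V
  O : Set V
  label : {v : V // v ∉ O} → MeasLabel

/-- The odd neighbourhood of `A`: the symmetric difference of the neighbourhoods of the elements of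
`A`, that is, the vertices with an odd number of neighbours in `A`. -/
def SimpleGraph.oddNbhd {V : Type*} (G : SimpleGraph V) (A : Set V) : Set V :=
  {v | Odd {u | u ∈ A ∧ G.Adj u v}.ncard}

/-- The closed odd neighbourhood of `A`. -/
def SimpleGraph.closedOddNbhd {V : Type*} (G : SimpleGraph V) (A : Set V) : Set V :=
  symmDiff (G.oddNbhd A) A

namespace LabelledOpenGraph

variable {V : Type*} (Γ : LabelledOpenGraph V)

/-- The non-output (measured) vertices. -/
abbrev NonOutput : Type _ := {v : V // v ∉ Γ.O}

/-- `(c, prec)` is a Pauli flow: `c` maps non-outputs to sets of non-inputs, `prec` is a strict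
partial order on the non-outputs, and the nine Pauli flow conditions hold. -/
structure IsPauliFlow (c : Γ.NonOutput → Set V) (prec : Γ.NonOutput → Γ.NonOutput → Prop) :
    Prop where
  subset_nonInput : ∀ u, c u ⊆ Γ.Iᶜ
  irrefl : ∀ u, ¬ prec u u
  trans : ∀ u v w, prec u v → prec v w → prec u w
  P1 : ∀ u v : Γ.NonOutput, v.1 ∈ c u → u ≠ v →
    Γ.label v ∉ ({.X, .Y} : Set MeasLabel) → prec u v
  P2 : ∀ u v : Γ.NonOutput, v.1 ∈ Γ.graph.oddNbhd (c u) → u ≠ v →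
    Γ.label v ∉ ({.Y, .Z} : Set MeasLabel) → prec u v
  P3 : ∀ u v : Γ.NonOutput, ¬ prec u v → u ≠ v → Γ.label v = .Y →
    v.1 ∉ Γ.graph.closedOddNbhd (c u)
  P4 : ∀ u, Γ.label u = .XY → u.1 ∉ c u ∧ u.1 ∈ Γ.graph.oddNbhd (c u)
  P5 : ∀ u, Γ.label u = .XZ → u.1 ∈ c u ∧ u.1 ∈ Γ.graph.oddNbhd (c u)
  P6 : ∀ u, Γ.label u = .YZ → u.1 ∈ c u ∧ u.1 ∉ Γ.graph.oddNbhd (c u)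
  P7 : ∀ u, Γ.label u = .X → u.1 ∈ Γ.graph.oddNbhd (c u)
  P8 : ∀ u, Γ.label u = .Z → u.1 ∈ c u
  P9 : ∀ u, Γ.label u = .Y → u.1 ∈ Γ.graph.closedOddNbhd (c u)

/-- `A` is focused over the set `S` of non-outputs. -/
structure FocusedOver (A : Set V) (S : Set Γ.NonOutput) : Prop where
  F1 : ∀ w ∈ S, w.1 ∈ A → Γ.label w ∈ ({.XY, .X, .Y} : Set MeasLabel)
  F2 : ∀ w ∈ S, w.1 ∈ Γ.graph.oddNbhd A → Γ.label w ∈ ({.XZ, .YZ, .Y, .Z} : Set MeasLabel)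
  F3 : ∀ w ∈ S, Γ.label w = .Y → w.1 ∉ Γ.graph.closedOddNbhd A

/-- A Pauli flow whose correction sets `c v` are focused over all non-outputs other than `v`. -/
structure IsFocusedPauliFlow (c : Γ.NonOutput → Set V)
    (prec : Γ.NonOutput → Γ.NonOutput → Prop) : Prop where
  isPauliFlow : Γ.IsPauliFlow c prec
  focused : ∀ v, Γ.FocusedOver (c v) {w | w ≠ v}

def HasPauliFlow : Prop :=
  ∃ (c : Γ.NonOutput → Set V) (prec : Γ.NonOutput → Γ.NonOutput → Prop), Γ.IsPauliFlow c prec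

/-- All measurements are planar. -/
def AllPlanar : Prop :=
  ∀ v, Γ.label v ∈ ({.XY, .XZ, .YZ} : Set MeasLabel)

/-- A gflow is a Pauli flow on a labelled open graph with only planar measurements. -/
def HasGflow : Prop := Γ.AllPlanar ∧ Γ.HasPauliFlow

/-- The `X`-like non-output vertices, inputs included. -/
def xLike : Set Γ.NonOutput :=
  {v | Γ.label v ∈ ({.XY, .X, .Y} : Set MeasLabel)}

/-- The planar measured internal vertices. -/
def planarInternal : Set Γ.NonOutput :=
  {v | v.1 ∉ Γ.I ∧ Γ.label v ∈ ({.XY, .XZ, .YZ} : Set MeasLabel)}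

/-- `K` is a set of non-inputs and `S` is the largest set of non-outputs over which `K` is
focused. -/
def IsLargestFocus (K : Set V) (S : Set Γ.NonOutput) : Prop :=
  K ⊆ Γ.Iᶜ ∧ Γ.FocusedOver K S ∧ ∀ T, Γ.FocusedOver K T → T ⊆ S

/-- `K` is a set of non-inputs for which the non-outputs outside `W ∩ xLike` form the largest set
over which `K` is focused. -/
def IsSplitCorrection (W K : Set V) : Prop :=
  Γ.IsLargestFocus K ({v | v.1 ∈ W} ∩ Γ.xLike)ᶜ

/-- The non-outputs whose correction set meets `W` in an odd number of vertices. -/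
def wPred (c : Γ.NonOutput → Set V) (W : Set V) : Set Γ.NonOutput :=
  {w | Odd (c w ∩ W).ncard}

/-- The planar measured internal vertices in `K ∪ (Odd(K) ∆ W)`. -/
def vSucc (W K : Set V) : Set Γ.NonOutput :=
  Γ.planarInternal ∩ {v | v.1 ∈ K ∪ symmDiff (Γ.graph.oddNbhd K) W}

/-- The conditions (V1)-(V4) for the unique set `K` with `IsSplitCorrection W K`. -/
structure SplitConditions (x : Γ.NonOutput) (W : Set V) (c : Γ.NonOutput → Set V)
    (prec : Γ.NonOutput → Γ.NonOutput → Prop) (K : Set V) : Prop where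
  K_unique : ∀ K', Γ.IsSplitCorrection W K' ↔ K' = K
  V1 : Even (W ∩ K).ncard
  V2 : ∀ w ∈ Γ.wPred c W, ∀ v ∈ Γ.vSucc W K, ¬ (prec v w ∨ v = w)
  V3 : ∀ u, (prec x u → u ∉ Γ.wPred c W) ∧ (prec u x → u ∉ Γ.vSucc W K)
  V4 : x.1 ∈ K ↔ Even (c x ∩ W).ncard

end LabelledOpenGraph

/-- The vertex set `V ∪ {x', x''}` after a splitting: `mid` is `x'` and `far` is `x''`. -/
inductive SplitVertex (V : Type*)
  | old (v : V)
  | mid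
  | far

/-- Splitting `x` over `W`: the new edge set is
`E ∆ {{x, x'}, {x', x''}} ∆ ({x, x''} × W)`, and both new vertices are measured `XY`. -/
def LabelledOpenGraph.split {V : Type*} (Γ : LabelledOpenGraph V) (x : V) (W : Set V) :
    LabelledOpenGraph (SplitVertex V) where
  graph := SimpleGraph.fromEdgeSet
    (symmDiff
      (symmDiff (Sym2.map SplitVertex.old '' Γ.graph.edgeSet)
        {s(SplitVertex.old x, SplitVertex.mid), s(SplitVertex.mid, SplitVertex.far)})
      {e | ∃ w ∈ W, e = s(SplitVertex.old x, SplitVertex.old w) ∨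
        e = s(SplitVertex.far, SplitVertex.old w)})
  I := SplitVertex.old '' Γ.I
  O := SplitVertex.old '' Γ.O
  label
    | ⟨.old v, h⟩ => Γ.label ⟨v, fun hv => h ⟨v, hv, rfl⟩⟩
    | ⟨.mid, _⟩ => .XY
    | ⟨.far, _⟩ => .XY

/-!
Identify a set `A` of vertices with its characteristic vector over `𝔽₂`. Being focused at a
non-output `w` is the vanishing of a linear form in `A`, and all these forms together are a linear
map `M` (`demand`) from vectors on the non-inputs to vectors on the non-outputs. The constraints on
the order form a second linear map `N` (`order`). A focused Pauli flow is a matrix `C` with `MC = 1`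
for which `NC` is contained in a strict partial order (`IsFlowInverse`). An arbitrary Pauli flow
makes `MC` unitriangular and `NC` strictly triangular, and replacing `C` by `C(MC)⁻¹` focuses it
(`IsPauliFlow.exists_isFlowInverse`). When `|I| = |O|` the matrix `M` is square, so `C = M⁻¹` is
unique, and so is the set `K`, the solution of `MK = 1_{W ∩ xLike}`.

Let `A` be a set of vertices of the split graph, with entries `a'` at `x'` and `a''` at `x''`. Its
demands are `A(x) + a''` at `x'`, `a' + |A ∩ W|` at `x''`, and `MA` at the old vertices, plus the
demand at `x'` times `1_{W ∩ xLike}`, plus the demand at `x''` times the unit vector of `x`. So the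
inverse for the split graph is explicit (`splitExtend`): up to the entries at the new vertices, the
correction sets of `u`, `x'` and `x''` are `c u`, `K` and `c x`. Its order demands are those of `Γ`
between old vertices, together with
* `w → x'` for `w ∈ wPred`, and `u → x''` whenever `u → x`;
* `x' → v` for `v ∈ vSucc`, `x' → x'` if `|W ∩ K|` is odd, and `x' → x''` if `x ∉ K`;
* `x'' → v` whenever `x → v`, and `x'' → x'` if `|c x ∩ W|` is even.

It remains to see that this relation is acyclic exactly when (V1)-(V4) hold for the order generated
by `Γ`. Each violation of one of these conditions closes a cycle
(`exists_splitConditions_of_hasPauliFlow_split`). Conversely, cycles avoiding `x'` project to `Γ`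
by `x'' ↦ x`, and cycles through `x'` are excluded by (V1)-(V4) (`SplitConditions.acyclic`).
-/

/-! ### Characteristic vectors over the field with two elements -/

open scoped Classical in
/-- The characteristic vector of a set over `𝔽₂`. -/
noncomputable def charVec {V : Type*} (A : Set V) : V → ZMod 2 :=
  fun v => if v ∈ A then 1 else 0

theorem ZMod.two_eq_zero_iff_ne_one {a : ZMod 2} : a = 0 ↔ a ≠ 1 := by
  revert a; decide

theorem charVec_eq_one {V : Type*} {A : Set V} {v : V} : charVec A v = 1 ↔ v ∈ A := by
  simp [charVec]

theorem charVec_eq_zero {V : Type*} {A : Set V} {v : V} : charVec A v = 0 ↔ v ∉ A := by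
  simp [charVec]

theorem charVec_setOf_eq_one {V : Type*} (f : V → ZMod 2) : charVec {v | f v = 1} = f := by
  funext v
  by_cases h : f v = 1
  · rw [h]; exact charVec_eq_one.2 h
  · rw [ZMod.two_eq_zero_iff_ne_one.2 h]; exact charVec_eq_zero.2 h

theorem charVec_injective {V : Type*} : Function.Injective (charVec : Set V → V → ZMod 2) := by
  intro A B h
  ext v
  rw [← charVec_eq_one, h, charVec_eq_one]

open scoped Classical in
/-- The sum of the entries of `f` on `W`; on characteristic vectors, the parity of `|A ∩ W|`. -/
noncomputable def sumOn {V : Type*} [Fintype V] (W : Set V) : (V → ZMod 2) →ₗ[ZMod 2] ZMod 2 :=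
  ∑ u, if u ∈ W then LinearMap.proj u else 0

open scoped Classical in
theorem sumOn_apply {V : Type*} [Fintype V] (W : Set V) (f : V → ZMod 2) :
    sumOn W f = ∑ u, if u ∈ W then f u else 0 := by
  simp only [sumOn, LinearMap.sum_apply]
  refine Finset.sum_congr rfl fun u _ => ?_
  split_ifs <;> rfl

theorem sumOn_charVec {V : Type*} [Fintype V] (W A : Set V) :
    sumOn W (charVec A) = ((A ∩ W).ncard : ZMod 2) := by
  classical
  rw [sumOn_apply, Set.ncard_eq_toFinset_card', Finset.card_eq_sum_ones, Nat.cast_sum,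
    ← Finset.sum_filter]
  simp only [charVec]
  rw [← Finset.sum_filter, Nat.cast_one]
  refine Finset.sum_congr ?_ fun _ _ => rfl
  ext v
  simp [and_comm]

theorem sumOn_charVec_eq_one {V : Type*} [Fintype V] {W A : Set V} :
    sumOn W (charVec A) = 1 ↔ Odd (A ∩ W).ncard := by
  rw [sumOn_charVec, ZMod.natCast_eq_one_iff_odd]

theorem sumOn_charVec_eq_zero {V : Type*} [Fintype V] {W A : Set V} :
    sumOn W (charVec A) = 0 ↔ Even (A ∩ W).ncard := by
  rw [sumOn_charVec, ZMod.natCast_eq_zero_iff_even]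

/-- The adjacency map of `G` over `𝔽₂`, taking characteristic vectors to those of odd
neighbourhoods. -/
noncomputable def SimpleGraph.oddMap {V : Type*} [Fintype V] (G : SimpleGraph V) :
    (V → ZMod 2) →ₗ[ZMod 2] (V → ZMod 2) :=
  LinearMap.pi fun v => sumOn {u | G.Adj u v}

theorem SimpleGraph.oddMap_apply {V : Type*} [Fintype V] (G : SimpleGraph V) (f : V → ZMod 2)
    (v : V) : G.oddMap f v = sumOn {u | G.Adj u v} f := rfl

theorem SimpleGraph.oddMap_charVec_eq_one {V : Type*} [Fintype V] {G : SimpleGraph V} {A : Set V}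
    {v : V} : G.oddMap (charVec A) v = 1 ↔ v ∈ G.oddNbhd A := by
  rw [oddMap_apply, sumOn_charVec_eq_one]; rfl

theorem SimpleGraph.oddMap_charVec {V : Type*} [Fintype V] (G : SimpleGraph V) (A : Set V) :
    G.oddMap (charVec A) = charVec (G.oddNbhd A) := by
  rw [← charVec_setOf_eq_one (G.oddMap (charVec A))]
  congr 1
  ext v
  exact oddMap_charVec_eq_one

/-! ### Flow demands and order demands -/

namespace MeasLabel

/-- The weight of `Odd(A)` in the flow demand of a vertex with the given label. -/
def demandOdd : MeasLabel → ZMod 2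
  | X | XY | Y => 1
  | Z | XZ | YZ => 0

/-- The weight of `A` in the flow demand of a vertex with the given label. -/
def demandSelf : MeasLabel → ZMod 2
  | X | XY => 0
  | Y | Z | XZ | YZ => 1

/-- The weight of `Odd(A)` in the order demand of a vertex with the given label. -/
def orderOdd : MeasLabel → ZMod 2
  | XZ | YZ => 1
  | X | Y | Z | XY => 0

/-- The weight of `A` in the order demand of a vertex with the given label. -/
def orderSelf : MeasLabel → ZMod 2
  | XY | XZ => 1
  | X | Y | Z | YZ => 0

end MeasLabel

namespace LabelledOpenGraph

variable {V : Type*} [Fintype V] (Γ : LabelledOpenGraph V)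

/-- The flow-demand map: at a non-output `w` it reads off whether `w` lies in `Odd(A)`, `Odd[A]` or
`A`, whichever of them a focused set has to avoid. -/
noncomputable def demand : (V → ZMod 2) →ₗ[ZMod 2] (Γ.NonOutput → ZMod 2) :=
  LinearMap.pi fun w => (Γ.label w).demandOdd • (LinearMap.proj w.1 ∘ₗ Γ.graph.oddMap) +
    (Γ.label w).demandSelf • LinearMap.proj w.1

theorem demand_apply (f : V → ZMod 2) (w : Γ.NonOutput) :
    Γ.demand f w =
      (Γ.label w).demandOdd * Γ.graph.oddMap f w + (Γ.label w).demandSelf * f w := rfl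

/-- The order-demand map: at a planar non-output `w` it reads off the complementary condition,
which for the correction set of `u ≠ w` forces `u ≺ w`; at Pauli labels it vanishes. On the
`XZ` vertices it reads off `Odd[A]`, so that it also vanishes at `u` itself. -/
noncomputable def order : (V → ZMod 2) →ₗ[ZMod 2] (Γ.NonOutput → ZMod 2) :=
  LinearMap.pi fun w => (Γ.label w).orderOdd • (LinearMap.proj w.1 ∘ₗ Γ.graph.oddMap) +
    (Γ.label w).orderSelf • LinearMap.proj w.1

theorem order_apply (f : V → ZMod 2) (w : Γ.NonOutput) :
    Γ.order f w =
      (Γ.label w).orderOdd * Γ.graph.oddMap f w + (Γ.label w).orderSelf * f w := rfl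

variable {Γ}

/-- Being focused is a linear condition. -/
theorem focusedOver_iff {A : Set V} {S : Set Γ.NonOutput} :
    Γ.FocusedOver A S ↔ ∀ w ∈ S, Γ.demand (charVec A) w = 0 := by
  have key : Γ.FocusedOver A S ↔ ∀ w ∈ S,
      (w.1 ∈ A → Γ.label w ∈ ({.XY, .X, .Y} : Set MeasLabel)) ∧
      (w.1 ∈ Γ.graph.oddNbhd A → Γ.label w ∈ ({.XZ, .YZ, .Y, .Z} : Set MeasLabel)) ∧
      (Γ.label w = .Y → w.1 ∉ Γ.graph.closedOddNbhd A) :=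
    ⟨fun h w hw => ⟨h.F1 w hw, h.F2 w hw, h.F3 w hw⟩,
      fun h => ⟨fun w hw => (h w hw).1, fun w hw => (h w hw).2.1, fun w hw => (h w hw).2.2⟩⟩
  rw [key]
  refine forall₂_congr fun w _ => ?_
  rw [demand_apply, SimpleGraph.oddMap_charVec]
  rcases hl : Γ.label w <;> by_cases h1 : w.1 ∈ A <;> by_cases h2 : w.1 ∈ Γ.graph.oddNbhd A <;>
    simp [charVec, MeasLabel.demandOdd, MeasLabel.demandSelf, h1, h2,
      SimpleGraph.closedOddNbhd, Set.mem_symmDiff, CharTwo.add_self_eq_zero]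

/-! ### Pauli flows as inverses of the flow-demand map -/

/-- A matrix form of a focused Pauli flow: `C` is a right inverse of the flow-demand map on the
vectors supported on the non-inputs, and its order demands are respected by the strict partial
order `prec`. -/
structure IsFlowInverse (C : Γ.NonOutput → V → ZMod 2) (prec : Γ.NonOutput → Γ.NonOutput → Prop) :
    Prop where
  input : ∀ u, ∀ i ∈ Γ.I, C u i = 0
  irrefl : ∀ u, ¬ prec u u
  trans : ∀ u v w, prec u v → prec v w → prec u w
  demand_self : ∀ u, Γ.demand (C u) u = 1
  demand_ne : ∀ u v, u ≠ v → Γ.demand (C u) v = 0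
  order : ∀ u v, Γ.order (C u) v = 1 → prec u v

/-- The conditions of a Pauli flow, read through the two demand maps: the flow-demand matrix is
unitriangular and the order-demand matrix strictly triangular for `prec`. -/
theorem IsPauliFlow.demand_order {c : Γ.NonOutput → Set V}
    {prec : Γ.NonOutput → Γ.NonOutput → Prop} (h : Γ.IsPauliFlow c prec) (u : Γ.NonOutput) :
    Γ.demand (charVec (c u)) u = 1 ∧
      (∀ v, u ≠ v → Γ.demand (charVec (c u)) v = 1 → prec u v) ∧
      ∀ v, Γ.order (charVec (c u)) v = 1 → prec u v := by
  have diag : Γ.demand (charVec (c u)) u = 1 ∧ Γ.order (charVec (c u)) u = 0 := by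
    rw [demand_apply, order_apply, SimpleGraph.oddMap_charVec]
    have h4 := h.P4 u
    have h5 := h.P5 u
    have h6 := h.P6 u
    have h7 := h.P7 u
    have h8 := h.P8 u
    have h9 := h.P9 u
    rcases hl : Γ.label u <;> rw [hl] at h4 h5 h6 h7 h8 h9 <;>
    by_cases h1 : u.1 ∈ c u <;> by_cases h2 : u.1 ∈ Γ.graph.oddNbhd (c u) <;>
    simp_all [charVec, MeasLabel.demandOdd, MeasLabel.demandSelf, MeasLabel.orderOdd,
      MeasLabel.orderSelf, SimpleGraph.closedOddNbhd, Set.mem_symmDiff, CharTwo.add_self_eq_zero]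
  have off : ∀ v, u ≠ v → (Γ.demand (charVec (c u)) v = 1 → prec u v) ∧
      (Γ.order (charVec (c u)) v = 1 → prec u v) := by
    intro v huv
    rw [demand_apply, order_apply, SimpleGraph.oddMap_charVec]
    have h1 := fun a => h.P1 u v a huv
    have h2 := fun a => h.P2 u v a huv
    have h3 := fun a => h.P3 u v a huv
    rcases hl : Γ.label v <;> rw [hl] at h1 h2 h3 <;>
    by_cases h1 : v.1 ∈ c u <;> by_cases h2 : v.1 ∈ Γ.graph.oddNbhd (c u) <;>
    by_cases h4 : prec u v <;>
    simp_all [charVec, MeasLabel.demandOdd, MeasLabel.demandSelf, MeasLabel.orderOdd,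
      MeasLabel.orderSelf, SimpleGraph.closedOddNbhd, Set.mem_symmDiff, CharTwo.add_self_eq_zero]
  refine ⟨diag.1, fun v hv => (off v hv).1, fun v hv => ?_⟩
  rcases eq_or_ne u v with rfl | huv
  · rw [diag.2] at hv; exact absurd hv zero_ne_one
  · exact (off v huv).2 hv

theorem IsFocusedPauliFlow.isFlowInverse {c : Γ.NonOutput → Set V}
    {prec : Γ.NonOutput → Γ.NonOutput → Prop} (h : Γ.IsFocusedPauliFlow c prec) :
    IsFlowInverse (fun u => charVec (c u)) prec where
  input u _ hi := charVec_eq_zero.2 fun hc => h.isPauliFlow.subset_nonInput u hc hi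
  irrefl := h.isPauliFlow.irrefl
  trans := h.isPauliFlow.trans
  demand_self u := (h.isPauliFlow.demand_order u).1
  demand_ne u v huv := focusedOver_iff.1 (h.focused u) v huv.symm
  order u := (h.isPauliFlow.demand_order u).2.2

theorem IsFlowInverse.isFocusedPauliFlow {c : Γ.NonOutput → Set V}
    {prec : Γ.NonOutput → Γ.NonOutput → Prop} (h : IsFlowInverse (fun u => charVec (c u)) prec) :
    Γ.IsFocusedPauliFlow c prec := by
  have off : ∀ u v, u ≠ v → Γ.demand (charVec (c u)) v = 0 := h.demand_ne
  have ord := h.order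
  have diag : ∀ u, Γ.demand (charVec (c u)) u = 1 ∧ Γ.order (charVec (c u)) u ≠ 1 :=
    fun u => ⟨h.demand_self u, fun hu => h.irrefl u (h.order u u hu)⟩
  simp only [demand_apply, order_apply, SimpleGraph.oddMap_charVec] at off ord diag
  refine ⟨⟨fun u v hv hI => charVec_eq_zero.1 (h.input u v hI) hv, h.irrefl, h.trans,
    ?_, ?_, ?_, ?_, ?_, ?_, ?_, ?_, ?_⟩,
    fun u => focusedOver_iff.2 fun v hv => h.demand_ne u v (Ne.symm hv)⟩
  · intro u v h1 huv h2
    have a := off u v huv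
    have b := ord u v
    clear off ord diag h
    rcases hl : Γ.label v <;> rw [hl] at a b h2 <;>
    by_cases h2 : v.1 ∈ Γ.graph.oddNbhd (c u) <;>
    simp_all [charVec, MeasLabel.demandOdd, MeasLabel.demandSelf, MeasLabel.orderOdd,
      MeasLabel.orderSelf]
  · intro u v h1 huv h2
    have a := off u v huv
    have b := ord u v
    clear off ord diag h
    rcases hl : Γ.label v <;> rw [hl] at a b h2 <;>
    by_cases h2 : v.1 ∈ c u <;>
    simp_all [charVec, MeasLabel.demandOdd, MeasLabel.demandSelf, MeasLabel.orderOdd,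
      MeasLabel.orderSelf]
  · intro u v _ huv hl
    have a := off u v huv
    clear off ord diag h
    rw [hl] at a
    by_cases h1 : v.1 ∈ c u <;> by_cases h2 : v.1 ∈ Γ.graph.oddNbhd (c u) <;>
    simp_all [charVec, MeasLabel.demandOdd, MeasLabel.demandSelf,
      SimpleGraph.closedOddNbhd, Set.mem_symmDiff]
  all_goals
    intro u hl
    have a := diag u
    clear off ord diag h
    rw [hl] at a
    by_cases h1 : u.1 ∈ c u <;> by_cases h2 : u.1 ∈ Γ.graph.oddNbhd (c u) <;>
    simp_all [charVec, MeasLabel.demandOdd, MeasLabel.demandSelf, MeasLabel.orderOdd,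
      MeasLabel.orderSelf, SimpleGraph.closedOddNbhd, Set.mem_symmDiff, CharTwo.add_self_eq_zero]

theorem IsFlowInverse.isFocusedPauliFlow_setOf {C : Γ.NonOutput → V → ZMod 2}
    {prec : Γ.NonOutput → Γ.NonOutput → Prop} (h : IsFlowInverse C prec) :
    Γ.IsFocusedPauliFlow (fun u => {v | C u v = 1}) prec := by
  apply IsFlowInverse.isFocusedPauliFlow
  simpa only [charVec_setOf_eq_one] using h

/-- Focusing: inverting the unitriangular flow-demand matrix of a Pauli flow, by recursion along
`prec` from its maximal elements downwards, keeps the order demands strictly triangular. -/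
theorem IsPauliFlow.exists_isFlowInverse {c : Γ.NonOutput → Set V}
    {prec : Γ.NonOutput → Γ.NonOutput → Prop} (h : Γ.IsPauliFlow c prec) :
    ∃ C, IsFlowInverse (Γ := Γ) C prec := by
  classical
  have step : ∀ u, ∃ f : V → ZMod 2, (∀ i ∈ Γ.I, f i = 0) ∧ Γ.demand f = Pi.single u 1 ∧
      ∀ v, Γ.order f v = 1 → prec u v := by
    have wf : WellFounded (Function.swap prec) := by
      have : IsTrans Γ.NonOutput (Function.swap prec) := ⟨fun a b d hab hbd => h.trans d b a hbd hab⟩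
      have : Std.Irrefl (Function.swap prec) := ⟨h.irrefl⟩
      exact Finite.wellFounded_of_trans_of_irrefl _
    intro u
    induction u using wf.induction with
    | _ u ih =>
    choose! F hI hd ho using ih
    obtain ⟨d1, d2, d3⟩ := h.demand_order u
    set S : Finset Γ.NonOutput := {v | u ≠ v ∧ Γ.demand (charVec (c u)) v = 1} with hS
    have hSp : ∀ v ∈ S, prec u v := fun v hv => by
      simp only [hS, Finset.mem_filter, Finset.mem_univ, true_and] at hv
      exact d2 v hv.1 hv.2
    refine ⟨charVec (c u) + ∑ v ∈ S, F v, ?_, ?_, ?_⟩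
    · intro i hi
      rw [Pi.add_apply, Finset.sum_apply, Finset.sum_eq_zero fun v hv => hI v (hSp v hv) i hi,
        add_zero]
      exact charVec_eq_zero.2 fun hc => h.subset_nonInput u hc hi
    · rw [map_add, map_sum, Finset.sum_congr rfl fun v hv => hd v (hSp v hv)]
      funext w
      rw [Pi.add_apply, Finset.sum_apply]
      simp only [Pi.single_apply, Finset.sum_ite_eq]
      by_cases hwu : w = u
      · subst hwu; simp [hS, d1]
      · by_cases hw : Γ.demand (charVec (c u)) w = 1
        · simp [hS, Ne.symm hwu, hwu, hw, CharTwo.add_self_eq_zero]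
        · simp [hS, hwu, ZMod.two_eq_zero_iff_ne_one.2 hw]
    · intro w hw
      by_contra hn
      have h0 : Γ.order (charVec (c u)) w = 0 :=
        ZMod.two_eq_zero_iff_ne_one.2 fun h1 => hn (d3 w h1)
      have h1 : ∀ v ∈ S, Γ.order (F v) w = 0 := fun v hv =>
        ZMod.two_eq_zero_iff_ne_one.2 fun h1 =>
          hn (h.trans u v w (hSp v hv) (ho v (hSp v hv) w h1))
      rw [map_add, map_sum, Pi.add_apply, Finset.sum_apply, h0, Finset.sum_eq_zero h1,
        add_zero] at hw
      exact zero_ne_one hw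
  choose C hI hd ho using step
  exact ⟨C, hI, h.irrefl, h.trans, fun u => by rw [hd, Pi.single_eq_same],
    fun u v huv => by rw [hd, Pi.single_eq_of_ne huv.symm], ho⟩

theorem IsFlowInverse.exists_demand_eq {C : Γ.NonOutput → V → ZMod 2}
    {prec : Γ.NonOutput → Γ.NonOutput → Prop} (h : IsFlowInverse C prec)
    (b : Γ.NonOutput → ZMod 2) :
    ∃ f : V → ZMod 2, (∀ i ∈ Γ.I, f i = 0) ∧ Γ.demand f = b := by
  classical
  refine ⟨∑ u, b u • C u, fun i hi => ?_, ?_⟩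
  · rw [Finset.sum_apply]
    exact Finset.sum_eq_zero fun u _ => by rw [Pi.smul_apply, h.input u i hi, smul_zero]
  · funext w
    rw [map_sum, Finset.sum_apply, Finset.sum_eq_single w]
    · rw [map_smul, Pi.smul_apply, h.demand_self, smul_eq_mul, mul_one]
    · intro u _ hu
      rw [map_smul, Pi.smul_apply, h.demand_ne u w hu, smul_zero]
    · simp

/-- When `|I| = |O|` the flow-demand matrix is square, so that its right inverse is two-sided:
a surjection between finite sets of the same size is injective. -/
theorem IsFlowInverse.demand_injective (hcard : Γ.I.ncard = Γ.O.ncard)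
    {C : Γ.NonOutput → V → ZMod 2} {prec : Γ.NonOutput → Γ.NonOutput → Prop}
    (h : IsFlowInverse C prec) {f g : V → ZMod 2} (hf : ∀ i ∈ Γ.I, f i = 0)
    (hg : ∀ i ∈ Γ.I, g i = 0) (hfg : Γ.demand f = Γ.demand g) : f = g := by
  classical
  let ext : ({v // v ∉ Γ.I} → ZMod 2) → V → ZMod 2 :=
    fun a v => if hv : v ∉ Γ.I then a ⟨v, hv⟩ else 0
  have ext_restrict : ∀ f : V → ZMod 2, (∀ i ∈ Γ.I, f i = 0) → ext (fun v => f v.1) = f := by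
    intro f hf
    funext v
    by_cases hv : v ∈ Γ.I
    · simp [ext, hv, hf v hv]
    · simp [ext, hv]
  have hsurj : Function.Surjective fun a => Γ.demand (ext a) := fun b => by
    obtain ⟨f, hf, hb⟩ := h.exists_demand_eq b
    exact ⟨fun v => f v.1, by simpa only [ext_restrict f hf] using hb⟩
  have hc : Nat.card {v // v ∉ Γ.I} = Nat.card Γ.NonOutput := by
    have h1 := Set.ncard_add_ncard_compl Γ.I
    have h2 := Set.ncard_add_ncard_compl Γ.O
    have h3 : Nat.card {v // v ∉ Γ.I} = Γ.Iᶜ.ncard := rfl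
    have h4 : Nat.card Γ.NonOutput = Γ.Oᶜ.ncard := rfl
    omega
  have hinj := (hsurj.bijective_of_nat_card_le (by rw [Nat.card_fun, Nat.card_fun, hc])).1
  have := @hinj (fun v => f v.1) (fun v => g v.1)
    (by simpa only [ext_restrict f hf, ext_restrict g hg] using hfg)
  rw [← ext_restrict f hf, ← ext_restrict g hg, this]

theorem IsFlowInverse.eq_of_isFlowInverse (hcard : Γ.I.ncard = Γ.O.ncard)
    {C C' : Γ.NonOutput → V → ZMod 2} {prec prec' : Γ.NonOutput → Γ.NonOutput → Prop}
    (h : IsFlowInverse C prec) (h' : IsFlowInverse C' prec') : C = C' := by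
  funext u
  refine h.demand_injective hcard (h.input u) (h'.input u) ?_
  funext v
  rcases eq_or_ne u v with rfl | huv
  · rw [h.demand_self, h'.demand_self]
  · rw [h.demand_ne u v huv, h'.demand_ne u v huv]

/-! ### The split correction set -/

/-- `K` is a split correction exactly when its flow demand is the indicator of `W ∩ xLike`. -/
theorem isSplitCorrection_iff {W K : Set V} :
    Γ.IsSplitCorrection W K ↔ (∀ i ∈ Γ.I, charVec K i = 0) ∧
      ∀ v, Γ.demand (charVec K) v = (Γ.label v).demandOdd * charVec W v := by
  have hind : ∀ v : Γ.NonOutput, (Γ.label v).demandOdd * charVec W v = 0 ↔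
      v ∈ ({v : Γ.NonOutput | v.1 ∈ W} ∩ Γ.xLike)ᶜ := by
    intro v
    by_cases hv : v.1 ∈ W <;> rcases hl : Γ.label v <;>
      simp [hv, hl, charVec, MeasLabel.demandOdd, xLike]
  constructor
  · rintro ⟨hI, hf, hmax⟩
    refine ⟨fun i hi => charVec_eq_zero.2 fun hK => hI hK hi, fun v => ?_⟩
    rw [focusedOver_iff] at hf
    have hz : Γ.demand (charVec K) v = 0 ↔ (Γ.label v).demandOdd * charVec W v = 0 := by
      rw [hind]
      refine ⟨fun h0 => hmax {v} (focusedOver_iff.2 ?_) rfl, hf v⟩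
      rintro w rfl
      exact h0
    generalize Γ.demand (charVec K) v = a at hz ⊢
    generalize (Γ.label v).demandOdd * charVec W v = b at hz ⊢
    revert a b
    decide
  · rintro ⟨hI, hd⟩
    refine ⟨fun v hv hvI => charVec_eq_zero.1 (hI v hvI) hv, focusedOver_iff.2 fun w hw => ?_,
      fun T hT v hv => ?_⟩
    · rw [hd]; exact (hind w).2 hw
    · rw [← hind, ← hd]; exact focusedOver_iff.1 hT v hv

theorem IsFlowInverse.isSplitCorrection_unique (hcard : Γ.I.ncard = Γ.O.ncard)
    {C : Γ.NonOutput → V → ZMod 2} {prec : Γ.NonOutput → Γ.NonOutput → Prop}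
    (h : IsFlowInverse C prec) {W K K' : Set V} (hK : Γ.IsSplitCorrection W K)
    (hK' : Γ.IsSplitCorrection W K') : K' = K := by
  rw [isSplitCorrection_iff] at hK hK'
  refine charVec_injective (h.demand_injective hcard hK'.1 hK.1 ?_)
  funext v
  rw [hK.2, hK'.2]

theorem IsFlowInverse.exists_isSplitCorrection
    {C : Γ.NonOutput → V → ZMod 2} {prec : Γ.NonOutput → Γ.NonOutput → Prop}
    (h : IsFlowInverse C prec) (W : Set V) : ∃ K, Γ.IsSplitCorrection W K := by
  obtain ⟨k, hI, hk⟩ := h.exists_demand_eq fun v => (Γ.label v).demandOdd * charVec W v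
  refine ⟨{v | k v = 1}, isSplitCorrection_iff.2 ?_⟩
  rw [charVec_setOf_eq_one]
  exact ⟨hI, congrFun hk⟩

/-- The members of `vSucc` are the vertices that must follow the vertex `x'` after splitting. -/
theorem mem_vSucc_iff {C : Γ.NonOutput → V → ZMod 2}
    {prec : Γ.NonOutput → Γ.NonOutput → Prop} (h : IsFlowInverse C prec) {W K : Set V}
    (hK : Γ.IsSplitCorrection W K) (v : Γ.NonOutput) :
    v ∈ Γ.vSucc W K ↔
      Γ.order (charVec K) v + (Γ.label v).orderOdd * charVec W v = 1 := by
  have hv := (isSplitCorrection_iff.1 hK).2 v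
  have hI := hK.1
  have hKI : v.1 ∈ K → v.1 ∉ Γ.I := fun a => hI a
  -- a vertex labelled `XZ` or `YZ` lies in its own correction set, so it is not an input
  have hCI : (Γ.label v = .XZ ∨ Γ.label v = .YZ) → v.1 ∉ Γ.I := by
    intro hl hvI
    have h1 := h.demand_self v
    rw [demand_apply, h.input v v.1 hvI] at h1
    rcases hl with hl | hl <;> rw [hl] at h1 <;> simp [MeasLabel.demandOdd] at h1
  rw [demand_apply, SimpleGraph.oddMap_charVec] at hv
  rw [order_apply, SimpleGraph.oddMap_charVec]
  rcases hl : Γ.label v <;> rw [hl] at hv hCI <;> by_cases h1 : v.1 ∈ K <;>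
  by_cases h2 : v.1 ∈ Γ.graph.oddNbhd K <;> by_cases h3 : v.1 ∈ W <;>
  simp_all [charVec, MeasLabel.demandOdd, MeasLabel.demandSelf, MeasLabel.orderOdd,
    MeasLabel.orderSelf, vSucc, planarInternal, Set.mem_symmDiff, CharTwo.add_self_eq_zero]

end LabelledOpenGraph

/-! ### The split graph -/

namespace SplitVertex

/-- `SplitVertex V` is `V` with two points added. -/
def equivOption (V : Type*) : SplitVertex V ≃ Option (Option V) where
  toFun
    | old v => some (some v)
    | mid => some none
    | far => none
  invFun
    | some (some v) => old v
    | some none => mid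
    | none => far
  left_inv v := by cases v <;> rfl
  right_inv v := by rcases v with _ | _ | v <;> rfl

instance {V : Type*} [Fintype V] : Fintype (SplitVertex V) :=
  Fintype.ofEquiv _ (equivOption V).symm

theorem sum_eq {V M : Type*} [Fintype V] [AddCommMonoid M] (f : SplitVertex V → M) :
    ∑ v, f v = f far + (f mid + ∑ v, f (old v)) := by
  rw [← (equivOption V).symm.sum_comp, Fintype.sum_option, Fintype.sum_option]
  rfl

end SplitVertex

namespace LabelledOpenGraph

open SplitVertex

section Adjacency

variable {V : Type*} {Γ : LabelledOpenGraph V} {x : V} {W : Set V}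

theorem split_adj_old_old (hW : x ∉ W) (u v : V) :
    (Γ.split x W).graph.Adj (old u) (old v) ↔
      Xor (Γ.graph.Adj u v) (u = x ∧ v ∈ W ∨ v = x ∧ u ∈ W) := by
  have h1 : s(old u, old v) ∈ Sym2.map SplitVertex.old '' Γ.graph.edgeSet ↔ Γ.graph.Adj u v := by
    have hinj : Function.Injective (Sym2.map (SplitVertex.old (V := V))) :=
      Sym2.map.injective fun a b h => by cases h; rfl
    rw [← Sym2.map_mk, hinj.mem_set_image, SimpleGraph.mem_edgeSet]
  have h2 : s(old u, old v) ∈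
      ({s(old x, mid), s(mid, far)} : Set (Sym2 (SplitVertex V))) ↔ False := by simp
  have h3 : (∃ w ∈ W, s(old u, old v) = s(old x, old w) ∨ s(old u, old v) = s(far, old w)) ↔
      (u = x ∧ v ∈ W ∨ v = x ∧ u ∈ W) := by
    simp only [Sym2.eq_iff, SplitVertex.old.injEq, reduceCtorEq, false_and, and_false, or_false]
    constructor
    · rintro ⟨w, hw, ⟨rfl, rfl⟩ | ⟨rfl, rfl⟩⟩
      · exact Or.inl ⟨rfl, hw⟩
      · exact Or.inr ⟨rfl, hw⟩
    · rintro (⟨rfl, h⟩ | ⟨rfl, h⟩)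
      · exact ⟨v, h, Or.inl ⟨rfl, rfl⟩⟩
      · exact ⟨u, h, Or.inr ⟨rfl, rfl⟩⟩
  have hne : Xor (Γ.graph.Adj u v) (u = x ∧ v ∈ W ∨ v = x ∧ u ∈ W) → old u ≠ old v := by
    rintro h hv
    cases hv
    rcases h with ⟨h, -⟩ | ⟨⟨rfl, h⟩ | ⟨rfl, h⟩, -⟩
    · exact Γ.graph.irrefl h
    · exact hW h
    · exact hW h
  rw [split, SimpleGraph.fromEdgeSet_adj, Set.mem_symmDiff, Set.mem_symmDiff, h1, h2,
    Set.mem_ofPred_eq, h3]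
  refine ⟨fun h => ?_, fun h => ⟨?_, hne h⟩⟩
  · simpa [Xor] using h.1
  · simpa [Xor] using h

theorem split_adj_old_mid (u : V) : (Γ.split x W).graph.Adj (old u) mid ↔ u = x := by
  have : ∀ e, Sym2.map SplitVertex.old e ≠ s(old u, mid) := by
    intro e; induction e with | _ a b => simp
  simp [split, Set.mem_symmDiff, this]

theorem split_adj_old_far (u : V) : (Γ.split x W).graph.Adj (old u) far ↔ u ∈ W := by
  have : ∀ e, Sym2.map SplitVertex.old e ≠ s(old u, far) := by
    intro e; induction e with | _ a b => simp
  simp [split, Set.mem_symmDiff, this]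

theorem split_adj_mid_far : (Γ.split x W).graph.Adj mid far := by
  have : ∀ e, Sym2.map (SplitVertex.old (V := V)) e ≠ s(mid, far) := by
    intro e; induction e with | _ a b => simp
  simp [split, Set.mem_symmDiff, this]

end Adjacency

section NonOutput

variable {V : Type*} {Γ : LabelledOpenGraph V}

/-- An old non-output as a non-output of the split graph. -/
def splitOld (x : V) (W : Set V) (u : Γ.NonOutput) : (Γ.split x W).NonOutput :=
  ⟨old u.1, by rintro ⟨v, hv, h⟩; cases h; exact u.2 hv⟩

/-- The vertex `x'` as a non-output of the split graph. -/
def splitMid (Γ : LabelledOpenGraph V) (x : V) (W : Set V) : (Γ.split x W).NonOutput :=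
  ⟨mid, by rintro ⟨v, hv, h⟩; cases h⟩

/-- The vertex `x''` as a non-output of the split graph. -/
def splitFar (Γ : LabelledOpenGraph V) (x : V) (W : Set V) : (Γ.split x W).NonOutput :=
  ⟨far, by rintro ⟨v, hv, h⟩; cases h⟩

theorem splitOld_inj {x : V} {W : Set V} {u v : Γ.NonOutput} :
    splitOld x W u = splitOld x W v ↔ u = v :=
  ⟨fun h => Subtype.ext (by injection congrArg Subtype.val h), congrArg _⟩

theorem splitOld_ne_splitMid {x : V} {W : Set V} {u : Γ.NonOutput} :
    splitOld x W u ≠ splitMid Γ x W :=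
  fun h => by injection congrArg Subtype.val h

theorem splitOld_ne_splitFar {x : V} {W : Set V} {u : Γ.NonOutput} :
    splitOld x W u ≠ splitFar Γ x W :=
  fun h => by injection congrArg Subtype.val h

theorem splitMid_ne_splitFar {x : V} {W : Set V} : splitMid Γ x W ≠ splitFar Γ x W :=
  fun h => by injection congrArg Subtype.val h

theorem split_nonOutput_cases {x : V} {W : Set V} {p : (Γ.split x W).NonOutput → Prop}
    (hold : ∀ u, p (splitOld x W u)) (hmid : p (splitMid Γ x W)) (hfar : p (splitFar Γ x W)) :
    ∀ u, p u
  | ⟨old v, h⟩ => hold ⟨v, fun hv => h ⟨v, hv, rfl⟩⟩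
  | ⟨mid, _⟩ => hmid
  | ⟨far, _⟩ => hfar

end NonOutput

variable {V : Type*} [Fintype V] {Γ : LabelledOpenGraph V}

theorem split_oddMap_mid {x : V} {W : Set V} (f : SplitVertex V → ZMod 2) :
    (Γ.split x W).graph.oddMap f mid = f (old x) + f far := by
  classical
  rw [SimpleGraph.oddMap_apply, sumOn_apply, SplitVertex.sum_eq]
  simp [split_adj_old_mid, split_adj_mid_far.symm, add_comm]

theorem split_oddMap_far {x : V} {W : Set V} (f : SplitVertex V → ZMod 2) :
    (Γ.split x W).graph.oddMap f far = f mid + sumOn W fun v => f (old v) := by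
  classical
  rw [SimpleGraph.oddMap_apply, sumOn_apply, sumOn_apply, SplitVertex.sum_eq]
  simp [split_adj_old_far, split_adj_mid_far]

theorem split_oddMap_old [DecidableEq V] {x : V} {W : Set V} (hW : x ∉ W)
    (f : SplitVertex V → ZMod 2) (v : V) :
    (Γ.split x W).graph.oddMap f (old v) = Γ.graph.oddMap (fun v => f (old v)) v +
      charVec W v * (f (old x) + f far) +
      if v = x then (f mid + sumOn W fun v => f (old v)) else 0 := by
  classical
  have hfar : (Γ.split x W).graph.Adj far (old v) ↔ v ∈ W := by
    rw [SimpleGraph.adj_comm, split_adj_old_far]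
  have hmid : (Γ.split x W).graph.Adj mid (old v) ↔ v = x := by
    rw [SimpleGraph.adj_comm, split_adj_old_mid]
  -- the edges toggled by the splitting contribute over `𝔽₂` additively
  have hold : ∀ u, (if (Γ.split x W).graph.Adj (old u) (old v) then f (old u) else 0) =
      (if Γ.graph.Adj u v then f (old u) else 0) +
      ((if u = x then charVec W v * f (old u) else 0) +
        if u ∈ W then (if v = x then f (old u) else 0) else 0) := by
    intro u
    simp only [split_adj_old_old hW, Xor, charVec]
    by_cases hux : u = x <;> by_cases hvx : v = x <;> by_cases huW : u ∈ W <;>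
      by_cases hvW : v ∈ W <;> by_cases ha : Γ.graph.Adj u v <;>
      simp_all [CharTwo.add_self_eq_zero]
  rw [SimpleGraph.oddMap_apply, sumOn_apply, SplitVertex.sum_eq, SimpleGraph.oddMap_apply,
    sumOn_apply, sumOn_apply]
  simp only [hold, hfar, hmid, Finset.sum_add_distrib, Finset.sum_ite_eq',
    Finset.mem_univ, if_true, Set.mem_ofPred_eq]
  by_cases hvx : v = x
  · simp [hvx, hW, charVec]; ring
  · by_cases hvW : v ∈ W <;> simp [hvx, hvW, charVec]
    ring

variable {x : Γ.NonOutput} {W : Set V}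

theorem split_demand_mid (f : SplitVertex V → ZMod 2) :
    (Γ.split x.1 W).demand f (splitMid Γ x.1 W) = f (old x.1) + f far := by
  have hl : (Γ.split x.1 W).label (splitMid Γ x.1 W) = .XY := rfl
  rw [demand_apply, hl]
  simp [MeasLabel.demandOdd, MeasLabel.demandSelf, splitMid, split_oddMap_mid]

theorem split_demand_far (f : SplitVertex V → ZMod 2) :
    (Γ.split x.1 W).demand f (splitFar Γ x.1 W) = f mid + sumOn W fun v => f (old v) := by
  have hl : (Γ.split x.1 W).label (splitFar Γ x.1 W) = .XY := rfl
  rw [demand_apply, hl]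
  simp [MeasLabel.demandOdd, MeasLabel.demandSelf, splitFar, split_oddMap_far]

theorem split_demand_old [DecidableEq Γ.NonOutput] (hx : Γ.label x = .XY) (hW : x.1 ∉ W)
    (f : SplitVertex V → ZMod 2) (v : Γ.NonOutput) :
    (Γ.split x.1 W).demand f (splitOld x.1 W v) = Γ.demand (fun v => f (old v)) v +
      (Γ.label v).demandOdd * charVec W v * (f (old x.1) + f far) +
      if v = x then (f mid + sumOn W fun v => f (old v)) else 0 := by
  classical
  have hl : (Γ.split x.1 W).label (splitOld x.1 W v) = Γ.label v := rfl
  have hv : (splitOld x.1 W v).1 = old v.1 := rfl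
  rw [demand_apply, hl, demand_apply, hv, split_oddMap_old hW]
  by_cases hvx : v = x
  · subst hvx; simp [hx, MeasLabel.demandOdd, MeasLabel.demandSelf]
  · rw [if_neg hvx, if_neg fun h => hvx (Subtype.ext h)]; ring

theorem split_order_mid (f : SplitVertex V → ZMod 2) :
    (Γ.split x.1 W).order f (splitMid Γ x.1 W) = f mid := by
  have hl : (Γ.split x.1 W).label (splitMid Γ x.1 W) = .XY := rfl
  rw [order_apply, hl]
  simp [MeasLabel.orderOdd, MeasLabel.orderSelf, splitMid]

theorem split_order_far (f : SplitVertex V → ZMod 2) :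
    (Γ.split x.1 W).order f (splitFar Γ x.1 W) = f far := by
  have hl : (Γ.split x.1 W).label (splitFar Γ x.1 W) = .XY := rfl
  rw [order_apply, hl]
  simp [MeasLabel.orderOdd, MeasLabel.orderSelf, splitFar]

theorem split_order_old (hx : Γ.label x = .XY) (hW : x.1 ∉ W)
    (f : SplitVertex V → ZMod 2) (v : Γ.NonOutput) :
    (Γ.split x.1 W).order f (splitOld x.1 W v) = Γ.order (fun v => f (old v)) v +
      (Γ.label v).orderOdd * charVec W v * (f (old x.1) + f far) := by
  classical
  have hl : (Γ.split x.1 W).label (splitOld x.1 W v) = Γ.label v := rfl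
  have hv : (splitOld x.1 W v).1 = old v.1 := rfl
  rw [order_apply, hl, order_apply, hv, split_oddMap_old hW]
  by_cases hvx : v = x
  · subst hvx; simp [hx, MeasLabel.orderOdd, MeasLabel.orderSelf]
  · rw [if_neg fun h => hvx (Subtype.ext h)]; ring

theorem order_label_XY (hx : Γ.label x = .XY) (f : V → ZMod 2) : Γ.order f x = f x := by
  rw [order_apply, hx]; simp [MeasLabel.orderOdd, MeasLabel.orderSelf]

theorem mem_wPred_iff {c : Γ.NonOutput → Set V} {w : Γ.NonOutput} :
    w ∈ Γ.wPred c W ↔ sumOn W (charVec (c w)) = 1 :=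
  sumOn_charVec_eq_one.symm

end LabelledOpenGraph

/-! ### Pauli flow on the split graph -/

theorem Relation.TransGen.avoid_or_through {α : Type*} {r : α → α → Prop} (p : α) {a b : α}
    (h : Relation.TransGen r a b) :
    Relation.TransGen (fun a b => r a b ∧ a ≠ p ∧ b ≠ p) a b ∨
      Relation.ReflTransGen r a p ∧ Relation.ReflTransGen r p b := by
  induction h with
  | single hab =>
    rename_i b
    by_cases ha : a = p
    · subst ha; exact Or.inr ⟨.refl, .single hab⟩
    by_cases hb : b = p
    · subst hb; exact Or.inr ⟨.single hab, .refl⟩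
    exact Or.inl (.single ⟨hab, ha, hb⟩)
  | tail hab hbc ih =>
    rename_i b c
    rcases ih with ih | ih
    · by_cases hb : b = p
      · subst hb; exact Or.inr ⟨hab.to_reflTransGen, .single hbc⟩
      by_cases hc : c = p
      · subst hc; exact Or.inr ⟨(hab.tail hbc).to_reflTransGen, .refl⟩
      exact Or.inl (ih.tail ⟨hbc, hb, hc⟩)
    · exact Or.inr ⟨ih.1, ih.2.tail hbc⟩

/-- A relation is acyclic if no cycle passes through `p` and none avoids `p`. -/
theorem Relation.TransGen.irrefl_of_avoid {α : Type*} {r : α → α → Prop} (p : α)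
    (hp : ¬ Relation.TransGen r p p)
    (hr : ∀ a, ¬ Relation.TransGen (fun a b => r a b ∧ a ≠ p ∧ b ≠ p) a a) (a : α) :
    ¬ Relation.TransGen r a a := by
  intro h
  rcases h.avoid_or_through p with h' | ⟨h1, h2⟩
  · exact hr a h'
  · exact hp ((Relation.TransGen.trans_right h2 h).trans_left h1)

theorem Relation.TransGen.of_trans {α : Type*} {r : α → α → Prop}
    (ht : ∀ a b c, r a b → r b c → r a c) {a b : α} (h : Relation.TransGen r a b) : r a b := by
  induction h with
  | single h => exact h
  | tail _ h ih => exact ht _ _ _ ih h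

namespace LabelledOpenGraph

open SplitVertex

/-- Definition of a function on the non-outputs of a split graph by cases. -/
def splitElim {V β : Type*} {Γ : LabelledOpenGraph V} {x : V} {W : Set V} (onOld : Γ.NonOutput → β)
    (onMid onFar : β) : (Γ.split x W).NonOutput → β
  | ⟨old v, h⟩ => onOld ⟨v, fun hv => h ⟨v, hv, rfl⟩⟩
  | ⟨mid, _⟩ => onMid
  | ⟨far, _⟩ => onFar

section Acyclicity

variable {V : Type*} {Γ : LabelledOpenGraph V} {x : Γ.NonOutput} {W : Set V}

/-- Conditions (V1)-(V4) rule out every cycle in the order demands of the split graph. A cycle that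
avoids `x'` projects to one in `prec` by sending `x''` to `x`; the vertices reachable from `x'` are
described explicitly, and `x'` is not among them. -/
theorem SplitConditions.acyclic {c : Γ.NonOutput → Set V}
    {prec : Γ.NonOutput → Γ.NonOutput → Prop} {K : Set V}
    (hirr : ∀ u, ¬ prec u u) (htrans : ∀ u v w, prec u v → prec v w → prec u w)
    (h : Γ.SplitConditions x W c prec K)
    {r : (Γ.split x.1 W).NonOutput → (Γ.split x.1 W).NonOutput → Prop}
    (old_old : ∀ u v, r (splitOld x.1 W u) (splitOld x.1 W v) → prec u v)
    (old_mid : ∀ u, r (splitOld x.1 W u) (splitMid Γ x.1 W) → u ∈ Γ.wPred c W)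
    (old_far : ∀ u, r (splitOld x.1 W u) (splitFar Γ x.1 W) → prec u x)
    (mid_old : ∀ v, r (splitMid Γ x.1 W) (splitOld x.1 W v) → v ∈ Γ.vSucc W K)
    (mid_mid : r (splitMid Γ x.1 W) (splitMid Γ x.1 W) → Odd (W ∩ K).ncard)
    (mid_far : r (splitMid Γ x.1 W) (splitFar Γ x.1 W) → x.1 ∉ K)
    (far_old : ∀ v, r (splitFar Γ x.1 W) (splitOld x.1 W v) → prec x v)
    (far_mid : r (splitFar Γ x.1 W) (splitMid Γ x.1 W) → Even (c x ∩ W).ncard)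
    (far_far : ¬ r (splitFar Γ x.1 W) (splitFar Γ x.1 W)) (a : (Γ.split x.1 W).NonOutput) :
    ¬ Relation.TransGen r a a := by
  refine Relation.TransGen.irrefl_of_avoid (splitMid Γ x.1 W) (fun hcyc => ?_) (fun a hcyc => ?_) a
  · let Q : (Γ.split x.1 W).NonOutput → Prop :=
      splitElim (fun v => (∃ s ∈ Γ.vSucc W K, s = v ∨ prec s v) ∨ (x.1 ∉ K ∧ prec x v))
        False (x.1 ∉ K)
    have base : ∀ y, r (splitMid Γ x.1 W) y → Q y := by
      refine split_nonOutput_cases (fun v hv => Or.inl ⟨v, mid_old v hv, Or.inl rfl⟩)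
        (fun hv => Nat.not_even_iff_odd.2 (mid_mid hv) h.V1) mid_far
    have step : ∀ y z, Q y → r y z → Q z := by
      refine split_nonOutput_cases (fun v => ?_) (fun _ hQ => hQ.elim) ?_
      · refine split_nonOutput_cases (fun w hQ hr => ?_) (fun hQ hr => ?_) (fun hQ hr => ?_)
        · have hvw := old_old v w hr
          rcases hQ with ⟨s, hs, rfl | hsv⟩ | ⟨hxK, hxv⟩
          · exact Or.inl ⟨_, hs, Or.inr hvw⟩
          · exact Or.inl ⟨s, hs, Or.inr (htrans _ _ _ hsv hvw)⟩
          · exact Or.inr ⟨hxK, htrans _ _ _ hxv hvw⟩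
        · have hv := old_mid v hr
          rcases hQ with ⟨s, hs, hsv⟩ | ⟨hxK, hxv⟩
          · exact h.V2 v hv s hs hsv.symm
          · exact (h.V3 v).1 hxv hv
        · have hvx := old_far v hr
          rcases hQ with ⟨s, hs, rfl | hsv⟩ | ⟨hxK, hxv⟩
          · exact absurd hs ((h.V3 _).2 hvx)
          · exact absurd hs ((h.V3 _).2 (htrans _ _ _ hsv hvx))
          · exact absurd (htrans _ _ _ hxv hvx) (hirr x)
      · refine split_nonOutput_cases (fun w hQ hr => Or.inr ⟨hQ, far_old w hr⟩)
          (fun hQ hr => hQ (h.V4.2 (far_mid hr))) (fun hQ _ => hQ)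
    have hQ : ∀ y, Relation.TransGen r (splitMid Γ x.1 W) y → Q y := by
      intro y hy
      induction hy with
      | single hy => exact base _ hy
      | tail _ hyz ih => exact step _ _ ih hyz
    exact hQ _ hcyc
  · let φ : (Γ.split x.1 W).NonOutput → Γ.NonOutput := splitElim id x x
    have hφ : ∀ y z, r y z → y ≠ splitMid Γ x.1 W → z ≠ splitMid Γ x.1 W → prec (φ y) (φ z) := by
      refine split_nonOutput_cases (fun v => ?_) (fun _ _ hne => absurd rfl hne) ?_
      · exact split_nonOutput_cases (fun w hr _ _ => old_old v w hr)
          (fun _ _ hne => absurd rfl hne) (fun hr _ _ => old_far v hr)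
      · exact split_nonOutput_cases (fun w hr _ _ => far_old w hr)
          (fun _ _ hne => absurd rfl hne) (fun hr _ _ => absurd hr far_far)
    exact hirr (φ a) ((hcyc.lift φ fun y z hyz => hφ y z hyz.1 hyz.2.1 hyz.2.2).of_trans htrans)

end Acyclicity

variable {V : Type*} [Fintype V] {Γ : LabelledOpenGraph V}

/-- The extension of `f` to the vertices of the split graph whose flow demands at `x'` and `x''` are
`b'` and `b''`. -/
noncomputable def splitExtend (x : V) (W : Set V) (f : V → ZMod 2) (b' b'' : ZMod 2) :
    SplitVertex V → ZMod 2
  | old v => f v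
  | mid => b'' + sumOn W f
  | far => b' + f x

theorem splitExtend_add_far (x : V) (W : Set V) (f : V → ZMod 2) (b' b'' : ZMod 2) :
    splitExtend x W f b' b'' (old x) + splitExtend x W f b' b'' far = b' := by
  rw [splitExtend, splitExtend, add_left_comm, CharTwo.add_self_eq_zero, add_zero]

theorem splitExtend_mid_add (x : V) (W : Set V) (f : V → ZMod 2) (b' b'' : ZMod 2) :
    splitExtend x W f b' b'' mid + sumOn W (fun v => splitExtend x W f b' b'' (old v)) = b'' := by
  simp only [splitExtend]
  rw [add_assoc, CharTwo.add_self_eq_zero, add_zero]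

variable {x : Γ.NonOutput} {W : Set V}

theorem split_order_splitExtend_old (hx : Γ.label x = .XY) (hW : x.1 ∉ W) (f : V → ZMod 2)
    (b' b'' : ZMod 2) (v : Γ.NonOutput) :
    (Γ.split x.1 W).order (splitExtend x.1 W f b' b'') (splitOld x.1 W v) =
      Γ.order f v + (Γ.label v).orderOdd * charVec W v * b' := by
  rw [split_order_old hx hW, splitExtend_add_far]
  rfl

/-- Given (V1)-(V4), the extensions of the correction vectors `c u`, of `K` and of `c x` are the
correction vectors of `u`, `x'` and `x''` in the split graph. -/
theorem SplitConditions.hasPauliFlow_split (hx : Γ.label x = .XY) (hW : x.1 ∉ W)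
    {c : Γ.NonOutput → Set V} {prec : Γ.NonOutput → Γ.NonOutput → Prop} {K : Set V}
    (hc : Γ.IsFocusedPauliFlow c prec) (h : Γ.SplitConditions x W c prec K) :
    (Γ.split x.1 W).HasPauliFlow := by
  classical
  have hC := hc.isFlowInverse
  have hK : Γ.IsSplitCorrection W K := (h.K_unique K).2 rfl
  obtain ⟨hKI, hKd⟩ := isSplitCorrection_iff.1 hK
  let C' : (Γ.split x.1 W).NonOutput → SplitVertex V → ZMod 2 :=
    splitElim (fun u => splitExtend x.1 W (charVec (c u)) 0 0)
      (splitExtend x.1 W (charVec K) 1 0) (splitExtend x.1 W (charVec (c x)) 0 1)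
  have C'_old : ∀ u, C' (splitOld x.1 W u) = splitExtend x.1 W (charVec (c u)) 0 0 := fun _ => rfl
  have C'_mid : C' (splitMid Γ x.1 W) = splitExtend x.1 W (charVec K) 1 0 := rfl
  have C'_far : C' (splitFar Γ x.1 W) = splitExtend x.1 W (charVec (c x)) 0 1 := rfl
  have hinp : ∀ u, ∀ i ∈ (Γ.split x.1 W).I, C' u i = 0 := by
    refine split_nonOutput_cases (fun u => ?_) ?_ ?_ <;> rintro _ ⟨i, hi, rfl⟩
    · exact hC.input u i hi
    · exact hKI i hi
    · exact hC.input x i hi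
  have hdem : ∀ u v, (Γ.split x.1 W).demand (C' u) v = if u = v then 1 else 0 := by
    have hsing : ∀ u v, Γ.demand (charVec (c u)) v = if u = v then 1 else 0 := fun u v => by
      rcases eq_or_ne u v with rfl | huv
      · rw [if_pos rfl]; exact hC.demand_self u
      · rw [if_neg huv]; exact hC.demand_ne u v huv
    refine split_nonOutput_cases (fun u => ?_) ?_ ?_
    · refine split_nonOutput_cases (fun v => ?_) ?_ ?_
      · rw [split_demand_old hx hW, C'_old, splitExtend_add_far, splitExtend_mid_add]
        simp only [splitExtend, hsing, splitOld_inj]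
        simp
      · rw [split_demand_mid, C'_old, splitExtend_add_far, if_neg splitOld_ne_splitMid]
      · rw [split_demand_far, C'_old, splitExtend_mid_add, if_neg splitOld_ne_splitFar]
    · refine split_nonOutput_cases (fun v => ?_) ?_ ?_
      · rw [split_demand_old hx hW, C'_mid, splitExtend_add_far, splitExtend_mid_add,
          if_neg splitOld_ne_splitMid.symm]
        simp only [splitExtend, hKd]
        simp [CharTwo.add_self_eq_zero]
      · rw [split_demand_mid, C'_mid, splitExtend_add_far, if_pos rfl]
      · rw [split_demand_far, C'_mid, splitExtend_mid_add, if_neg splitMid_ne_splitFar]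
    · refine split_nonOutput_cases (fun v => ?_) ?_ ?_
      · rw [split_demand_old hx hW, C'_far, splitExtend_add_far, splitExtend_mid_add,
          if_neg splitOld_ne_splitFar.symm]
        simp only [splitExtend, hsing, eq_comm (a := x)]
        simp [CharTwo.add_self_eq_zero]
      · rw [split_demand_mid, C'_far, splitExtend_add_far, if_neg splitMid_ne_splitFar.symm]
      · rw [split_demand_far, C'_far, splitExtend_mid_add, if_pos rfl]
  let r : (Γ.split x.1 W).NonOutput → (Γ.split x.1 W).NonOutput → Prop :=
    fun u v => (Γ.split x.1 W).order (C' u) v = 1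
  have hacyc : ∀ u, ¬ Relation.TransGen r u u := by
    have hxx : charVec (c x) x.1 = 0 := by
      rw [ZMod.two_eq_zero_iff_ne_one, ← order_label_XY hx (charVec (c x))]
      exact fun h1 => hC.irrefl x (hC.order x x h1)
    refine h.acyclic hC.irrefl hC.trans (fun u v hr => ?_) (fun u hr => ?_) (fun u hr => ?_)
      (fun v hr => ?_) (fun hr => ?_) (fun hr => ?_) (fun v hr => ?_) (fun hr => ?_)
      (fun hr => ?_)
    · refine hC.order u v ?_
      simpa only [r, split_order_splitExtend_old hx hW, C'_old, mul_zero, add_zero] using hr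
    · rw [mem_wPred_iff]
      simpa only [r, split_order_mid, C'_old, splitExtend, zero_add] using hr
    · refine hC.order u x ?_
      rw [order_label_XY hx]
      simpa only [r, split_order_far, C'_old, splitExtend, zero_add] using hr
    · rw [mem_vSucc_iff hC hK]
      simpa only [r, split_order_splitExtend_old hx hW, C'_mid, mul_one] using hr
    · rw [Set.inter_comm, ← sumOn_charVec_eq_one]
      simpa only [r, split_order_mid, C'_mid, splitExtend, zero_add] using hr
    · rw [← charVec_eq_zero]
      simpa only [r, split_order_far, C'_mid, splitExtend, add_eq_left] using hr
    · refine hC.order x v ?_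
      simpa only [r, split_order_splitExtend_old hx hW, C'_far, mul_zero, add_zero] using hr
    · rw [← sumOn_charVec_eq_zero]
      simpa only [r, split_order_mid, C'_far, splitExtend, add_eq_left] using hr
    · have hr0 : charVec (c x) x.1 = 1 := by
        simpa only [r, split_order_far, C'_far, splitExtend, zero_add] using hr
      exact zero_ne_one (hxx.symm.trans hr0)
  have hflow : IsFlowInverse C' (Relation.TransGen r) :=
    ⟨hinp, hacyc, fun _ _ _ => Relation.TransGen.trans, fun u => by rw [hdem, if_pos rfl],
      fun u v huv => by rw [hdem, if_neg huv], fun u v huv => Relation.TransGen.single (r := r) huv⟩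
  exact ⟨_, _, hflow.isFocusedPauliFlow_setOf.isPauliFlow⟩

/-- Restricting the correction vectors of a flow on the split graph to the old vertices gives the
focused flow on `Γ` and the set `K`. Its order is taken to be the one generated by the order
demands: (V3) is about chains that start or end at `x`, and for the generated order such a chain can
be moved to start or end at `x''` instead. -/
theorem exists_splitConditions_of_hasPauliFlow_split (hcard : Γ.I.ncard = Γ.O.ncard)
    (hxI : x.1 ∉ Γ.I) (hx : Γ.label x = .XY) (hW : x.1 ∉ W)
    (h' : (Γ.split x.1 W).HasPauliFlow) :
    ∃ c prec K, Γ.IsFocusedPauliFlow c prec ∧ Γ.SplitConditions x W c prec K := by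
  classical
  obtain ⟨c', P, hc'⟩ := h'
  obtain ⟨C', h⟩ := hc'.exists_isFlowInverse
  set o := splitOld x.1 W with ho
  set m := splitMid Γ x.1 W with hm
  set f := splitFar Γ x.1 W with hf
  let C : Γ.NonOutput → V → ZMod 2 := fun u v => C' (o u) (old v)
  let k : V → ZMod 2 := fun v => C' m (old v)
  let g : V → ZMod 2 := fun v => C' f (old v)
  -- the demands at the two new vertices determine the values there
  have o1 : ∀ u, C u x.1 + C' (o u) far = 0 := fun u =>
    (split_demand_mid _).symm.trans (h.demand_ne (o u) m splitOld_ne_splitMid)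
  have o2 : ∀ u, C' (o u) mid + sumOn W (C u) = 0 := fun u =>
    (split_demand_far _).symm.trans (h.demand_ne (o u) f splitOld_ne_splitFar)
  have m1 : k x.1 + C' m far = 1 := (split_demand_mid _).symm.trans (h.demand_self m)
  have m2 : C' m mid + sumOn W k = 0 :=
    (split_demand_far _).symm.trans (h.demand_ne m f splitMid_ne_splitFar)
  have f1 : g x.1 + C' f far = 0 :=
    (split_demand_mid _).symm.trans (h.demand_ne f m splitMid_ne_splitFar.symm)
  have f2 : C' f mid + sumOn W g = 1 := (split_demand_far _).symm.trans (h.demand_self f)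
  have Cd : ∀ u v, Γ.demand (C u) v = (Γ.split x.1 W).demand (C' (o u)) (o v) := fun u v => by
    have := o1 u
    have := o2 u
    simp_all only [C, split_demand_old hx hW, mul_zero, add_zero, ite_self]
  have kd : ∀ v, Γ.demand k v = (Γ.label v).demandOdd * charVec W v := fun v => by
    have h0 := h.demand_ne m (o v) splitOld_ne_splitMid.symm
    rw [ho, split_demand_old hx hW] at h0
    change Γ.demand k v + _ * (k x.1 + C' m far) +
      (if v = x then C' m mid + sumOn W k else 0) = 0 at h0
    rw [m1, m2, mul_one, ite_self, add_zero] at h0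
    exact CharTwo.add_eq_zero.1 h0
  have gd : ∀ v, Γ.demand g v = if v = x then 1 else 0 := fun v => by
    have h0 := h.demand_ne f (o v) splitOld_ne_splitFar.symm
    rw [ho, split_demand_old hx hW] at h0
    change Γ.demand g v + _ * (g x.1 + C' f far) +
      (if v = x then C' f mid + sumOn W g else 0) = 0 at h0
    rw [f1, f2, mul_zero, add_zero] at h0
    exact CharTwo.add_eq_zero.1 h0
  let r : Γ.NonOutput → Γ.NonOutput → Prop := fun u v => Γ.order (C u) v = 1
  have E_old_old : ∀ u v, r u v → P (o u) (o v) := fun u v hr => by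
    refine h.order _ _ ?_
    rw [ho, split_order_old hx hW]
    change Γ.order (C u) v + _ * (C u x.1 + C' (o u) far) = 1
    rw [o1, mul_zero, add_zero]
    exact hr
  have E_old_far : ∀ u, r u x → P (o u) f := fun u hr => by
    refine h.order _ _ ?_
    rw [hf, split_order_far, ← CharTwo.add_eq_zero.1 (o1 u), ← order_label_XY hx (C u)]
    exact hr
  have T_old_old : ∀ u v, Relation.TransGen r u v → P (o u) (o v) := fun u v hr =>
    (hr.lift o E_old_old).of_trans h.trans
  have hC : IsFlowInverse C (Relation.TransGen r) :=
    ⟨fun u i hi => h.input (o u) (old i) ⟨i, hi, rfl⟩, fun u hu => h.irrefl _ (T_old_old u u hu),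
      fun _ _ _ => Relation.TransGen.trans, fun u => (Cd u u).trans (h.demand_self _),
      fun u v huv => (Cd u v).trans (h.demand_ne _ _ fun he => huv (splitOld_inj.1 he)),
      fun u v huv => Relation.TransGen.single (r := r) huv⟩
  have hg : g = C x := by
    refine hC.demand_injective hcard (fun i hi => h.input f (old i) ⟨i, hi, rfl⟩) (hC.input x) ?_
    funext v
    rw [gd]
    rcases eq_or_ne v x with rfl | hv
    · rw [if_pos rfl, hC.demand_self]
    · rw [if_neg hv, hC.demand_ne x v hv.symm]
  let K : Set V := {v | k v = 1}
  have hKk : charVec K = k := charVec_setOf_eq_one k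
  have hK : Γ.IsSplitCorrection W K := isSplitCorrection_iff.2 (by
    rw [hKk]; exact ⟨fun i hi => h.input m (old i) ⟨i, hi, rfl⟩, kd⟩)
  let c : Γ.NonOutput → Set V := fun u => {v | C u v = 1}
  have hcC : ∀ u, charVec (c u) = C u := fun u => charVec_setOf_eq_one (C u)
  have E_old_mid : ∀ u ∈ Γ.wPred c W, P (o u) m := fun u hu => by
    rw [mem_wPred_iff, hcC] at hu
    refine h.order _ _ ?_
    rw [hm, split_order_mid, CharTwo.add_eq_zero.1 (o2 u), hu]
  have E_mid_old : ∀ v ∈ Γ.vSucc W K, P m (o v) := fun v hv => by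
    rw [mem_vSucc_iff hC hK, hKk] at hv
    refine h.order _ _ ?_
    rw [ho, split_order_old hx hW]
    change Γ.order k v + _ * (k x.1 + C' m far) = 1
    rw [m1, mul_one, hv]
  have E_mid_far : x.1 ∉ K → P m f := fun hxK => by
    refine h.order _ _ ?_
    rw [← charVec_eq_zero, hKk] at hxK
    rw [hf, split_order_far, ← m1, hxK, zero_add]
  have E_far_old : ∀ v, r x v → P f (o v) := fun v hr => by
    refine h.order _ _ ?_
    rw [ho, split_order_old hx hW]
    change Γ.order g v + _ * (g x.1 + C' f far) = 1
    rw [f1, mul_zero, add_zero, hg]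
    exact hr
  have E_far_mid : Even (c x ∩ W).ncard → P f m := fun he => by
    rw [← sumOn_charVec_eq_zero, hcC, ← hg] at he
    refine h.order _ _ ?_
    rw [hm, split_order_mid, ← f2, he, add_zero]
  have T_old_far : ∀ u, Relation.TransGen r u x → P (o u) f := fun u hr => by
    cases hr with
    | single hr => exact E_old_far u hr
    | tail hr hr' => exact h.trans _ _ _ (T_old_old _ _ hr) (E_old_far _ hr')
  have T_far_old : ∀ v, Relation.TransGen r x v → P f (o v) := fun v hr => by
    induction hr with
    | single hr => exact E_far_old _ hr
    | tail _ hr ih => exact h.trans _ _ _ ih (E_old_old _ _ hr)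
  have hxS : x.1 ∈ K → x ∈ Γ.vSucc W K := fun hxK =>
    ⟨⟨hxI, by simp [hx]⟩, Or.inl hxK⟩
  have hxP : ¬ Even (c x ∩ W).ncard → x ∈ Γ.wPred c W := Nat.not_even_iff_odd.1
  refine ⟨c, Relation.TransGen r, K, hC.isFocusedPauliFlow_setOf, ?_, ?_, ?_, ?_, ?_⟩
  · exact fun K' => ⟨fun hK' => hC.isSplitCorrection_unique hcard hK hK', fun he => he ▸ hK⟩
  · rw [Set.inter_comm, ← sumOn_charVec_eq_zero, hKk, ZMod.two_eq_zero_iff_ne_one]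
    intro h1
    refine h.irrefl m (h.order _ _ ?_)
    rw [hm, split_order_mid, CharTwo.add_eq_zero.1 m2, h1]
  · rintro w hw v hv (hvw | rfl)
    · exact h.irrefl _ (h.trans _ _ _ (E_mid_old v hv)
        (h.trans _ _ _ (T_old_old v w hvw) (E_old_mid w hw)))
    · exact h.irrefl _ (h.trans _ _ _ (E_mid_old v hv) (E_old_mid v hw))
  · refine fun u => ⟨fun hxu hu => ?_, fun hux hu => ?_⟩
    · by_cases hxK : x.1 ∈ K
      · exact h.irrefl _ (h.trans _ _ _ (E_mid_old x (hxS hxK))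
          (h.trans _ _ _ (T_old_old x u hxu) (E_old_mid u hu)))
      · exact h.irrefl _ (h.trans _ _ _ (E_mid_far hxK)
          (h.trans _ _ _ (T_far_old u hxu) (E_old_mid u hu)))
    · by_cases he : Even (c x ∩ W).ncard
      · exact h.irrefl _ (h.trans _ _ _ (E_mid_old u hu)
          (h.trans _ _ _ (T_old_far u hux) (E_far_mid he)))
      · exact h.irrefl _ (h.trans _ _ _ (E_mid_old u hu)
          (h.trans _ _ _ (T_old_old u x hux) (E_old_mid x (hxP he))))
  · constructor
    · intro hxK
      by_contra he
      exact h.irrefl _ (h.trans _ _ _ (E_mid_old x (hxS hxK)) (E_old_mid x (hxP he)))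
    · intro he
      by_contra hxK
      exact h.irrefl _ (h.trans _ _ _ (E_mid_far hxK) (E_far_mid he))

theorem AllPlanar.split {V : Type*} {Γ : LabelledOpenGraph V} (h : Γ.AllPlanar) (x : V)
    (W : Set V) : (Γ.split x W).AllPlanar :=
  split_nonOutput_cases (fun u => h u) (Or.inl rfl) (Or.inl rfl)

end LabelledOpenGraph

open LabelledOpenGraph

theorem mainTheorem3 {V : Type*} [Finite V] (Γ : LabelledOpenGraph V)
    (hcard : Γ.I.ncard = Γ.O.ncard)
    (x : Γ.NonOutput) (hxI : x.1 ∉ Γ.I) (hx : Γ.label x = MeasLabel.XY)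
    (W : Set V) (hW : x.1 ∉ W) :
    -- the focused correction function is unique
    (∀ c prec c' prec', Γ.IsFocusedPauliFlow c prec → Γ.IsFocusedPauliFlow c' prec' → c = c') ∧
    -- the set `K` exists and is unique
    (Γ.HasPauliFlow → ∃! K : Set V, Γ.IsSplitCorrection W K) ∧
    ((Γ.split x.1 W).HasPauliFlow ↔
      ∃ c prec K, Γ.IsFocusedPauliFlow c prec ∧ Γ.SplitConditions x W c prec K) ∧
    (Γ.AllPlanar →
      (Γ.split x.1 W).AllPlanar ∧
      ((Γ.split x.1 W).HasGflow ↔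
        ∃ c prec K, Γ.IsFocusedPauliFlow c prec ∧ Γ.SplitConditions x W c prec K)) := by
  have := Fintype.ofFinite V
  have main : (Γ.split x.1 W).HasPauliFlow ↔
      ∃ c prec K, Γ.IsFocusedPauliFlow c prec ∧ Γ.SplitConditions x W c prec K :=
    ⟨exists_splitConditions_of_hasPauliFlow_split hcard hxI hx hW,
      fun ⟨_, _, _, hc, h⟩ => h.hasPauliFlow_split hx hW hc⟩
  refine ⟨fun c prec c' prec' h h' => ?_, fun ⟨c, prec, h⟩ => ?_, main,
    fun hpl => ⟨hpl.split x.1 W, ?_⟩⟩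
  · have heq := h.isFlowInverse.eq_of_isFlowInverse hcard h'.isFlowInverse
    exact funext fun u => charVec_injective (congrFun heq u)
  · obtain ⟨C, hC⟩ := h.exists_isFlowInverse
    obtain ⟨K, hK⟩ := hC.exists_isSplitCorrection W
    exact ⟨K, hK, fun K' hK' => hC.isSplitCorrection_unique hcard hK hK'⟩
  · rw [HasGflow, and_iff_right (hpl.split x.1 W), main]
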